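/- Let $G$ be a finite bi-block graph, that is, a connected graph each of whose blocks (maximal connected subgraphs without a cut-vertex) is a complete bipartite graph. Let $G$ have $r>1$ blocks $K_{m_i,n_i}$, $1\le i\le r$, the vertex set of the $i$-th block being partitioned into the nonempty parts $X_i\cup Y_i$ with $|X_i|=m_i$ and $|Y_i|=n_i$. Let $F$ be a field and let $q\in F$ satisfy $q\neq -1$ and, for all $1\le i\le r$, $$q^2(m_i-1)(n_i-1)\neq 1\qquad\text{and}\qquad (q+1)^2(m_i-1)(n_i-1)\neq m_in_i .$$ Let $\mathscr D$ be the $q$-distance matrix of $G$, i.e. $\mathscr D_{uv}=1+q+\cdots+q^{d(u,v)-1}$ for $u\ne v$ and $\mathscr D_{uu}=0$, where $d$ is the graph distance. Write $w_i=q^2(m_i-1)(n_i-1)-1$, and let $k(v)$ be the number of blocks containing the vertex $v$. Define vectors $\mathbf x,\mathbf y$ by $$\mathbf x(v)=\sum_{i:\,v\in X_i}\frac{q(n_i-1)-1}{(q+1)w_i}+\sum_{i:\,v\in Y_i}\frac{q(m_i-1)-1}{(q+1)w_i}-(k(v)-1),$$ $$\mathbf y(v)=\sum_{i:\,v\in X_i}\frac{n_i-1}{w_i}+\sum_{i:\,v\in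 Y_i}\frac{m_i-1}{w_i}-(k(v)-1),$$ and matrices $\mathbf A=(a_{uv})$, $\mathbf B=(b_{uv})$ by $a_{uv}=\frac1{w_i}$ if $u\sim v$ and $u,v$ lie in the $i$-th block, and $a_{uv}=0$ otherwise; $b_{uv}=\frac{n_i-1}{w_i}$ if $u\ne v$, $u\not\sim v$ and $u,v\in X_i$, $b_{uv}=\frac{m_i-1}{w_i}$ if $u\ne v$, $u\not\sim v$ and $u,v\in Y_i$, and $b_{uv}=0$ otherwise. Put $$\mathscr L=\frac{q}{q+1}\mathbf A-\frac{q^2}{q+1}\mathbf B-\frac{q^2}{q+1}\operatorname{diag}(\mathbf y)+\frac1{q+1}\mathbf I,\qquad \lambda_G=\sum_{i=1}^r\frac{(q+1)^2(m_i-1)(n_i-1)-m_in_i}{(q+1)\,\bigl(q^2(m_i-1)(n_i-1)-1\bigr)} .$$ Then $\mathscr D$ is invertible if and only if $\lambda_G\neq 0$, and in that case $$\mathscr D^{-1}=-\mathscr L+\frac1{\lambda_G}\,\mathbf x\mathbf x^T .$$ Moreover $\lambda_G\ne0$ whenever $q$ is transcendental over the integers (in particular, when $q$ is an indeterminate and $F=\mathbb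 Q(q)$), so that in this case the formula holds without any further assumption. -/

import Mathlib

open scoped Matrix

namespace SimpleGraph

variable {V : Type*}

/-- Deleting the vertex `v` disconnects the subgraph `H`. (The empty graph counts as not
disconnected, so the vertex of a one-vertex graph is no cut-vertex.) -/
def Subgraph.IsCutVertex {G : SimpleGraph V} (H : G.Subgraph) (v : V) : Prop :=
  v ∈ H.verts ∧ ¬ (H.deleteVerts {v}).Preconnected

/-- A block of `G`: a maximal connected subgraph with no cut-vertex. -/
def IsBlock (G : SimpleGraph V) (B : G.Subgraph) : Prop :=
  Maximal (fun H : G.Subgraph => H.Connected ∧ ∀ v, ¬ H.IsCutVertex v) B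

/-- `H` is a complete bipartite graph with the (nonempty) parts `X` and `Y`. -/
structure Subgraph.IsCompleteBipartiteWith {G : SimpleGraph V} (H : G.Subgraph)
    (X Y : Finset V) : Prop where
  nonempty_left : X.Nonempty
  nonempty_right : Y.Nonempty
  disjoint : Disjoint X Y
  verts_eq : H.verts = (X : Set V) ∪ (Y : Set V)
  adj_iff : ∀ u v, H.Adj u v ↔ (u ∈ X ∧ v ∈ Y) ∨ (u ∈ Y ∧ v ∈ X)

/-- A bi-block graph: a connected graph each of whose blocks is complete bipartite. -/
structure IsBiBlock (G : SimpleGraph V) : Prop where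
  connected : G.Connected
  completeBipartite : ∀ B : G.Subgraph, G.IsBlock B →
    ∃ X Y : Finset V, B.IsCompleteBipartiteWith X Y

/-- An enumeration of all the blocks of `G`, without repetition, by `Fin r`, together with a
bipartition `X i ∪ Y i` of the `i`-th block as a complete bipartite graph. -/
structure BiBlockLabelling (G : SimpleGraph V) (r : ℕ) where
  block : Fin r ≃ {B : G.Subgraph // G.IsBlock B}
  X : Fin r → Finset V
  Y : Fin r → Finset V
  isCompleteBipartiteWith : ∀ i, (block i).1.IsCompleteBipartiteWith (X i) (Y i)

/-- Every finite bi-block graph has such an enumeration. -/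
theorem IsBiBlock.exists_labelling [Finite V] {G : SimpleGraph V} (hG : G.IsBiBlock) :
    ∃ r, Nonempty (G.BiBlockLabelling r) := by
  obtain ⟨r, ⟨e⟩⟩ := Finite.exists_equiv_fin {B : G.Subgraph // G.IsBlock B}
  choose X Y h using fun i : Fin r => hG.completeBipartite (e.symm i).1 (e.symm i).2
  exact ⟨r, ⟨⟨e.symm, X, Y, h⟩⟩⟩

/-- The `q`-distance matrix: the `(u, v)` entry is `1 + q + ⋯ + q ^ (d(u, v) - 1)`, which is `0`
for `u = v`. -/
noncomputable def qDistMatrix {F : Type*} [Field F] (G : SimpleGraph V) (q : F) : Matrix V V F :=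
  Matrix.of fun u v => ∑ k ∈ Finset.range (G.dist u v), q ^ k

namespace BiBlockLabelling

variable {G : SimpleGraph V} {r : ℕ} (P : G.BiBlockLabelling r)

/-- `m i = |X i|`. -/
def m (i : Fin r) : ℕ := (P.X i).card

/-- `n i = |Y i|`. -/
def n (i : Fin r) : ℕ := (P.Y i).card

variable {F : Type*} [Field F] (q : F)

/-- `q² (m i - 1) (n i - 1) - 1`, the denominator attached to the `i`-th block. -/
def den (i : Fin r) : F := q ^ 2 * ((P.m i : F) - 1) * ((P.n i : F) - 1) - 1

/-- `λ_G`, the sum over the blocks. -/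
def lam : F :=
  ∑ i, ((q + 1) ^ 2 * ((P.m i : F) - 1) * ((P.n i : F) - 1) - (P.m i : F) * (P.n i : F)) /
    ((q + 1) * P.den q i)

variable [DecidableEq V]

/-- The block degree of `v`: the number of blocks containing `v`. -/
def blockDegree (v : V) : ℕ := (Finset.univ.filter fun i => v ∈ P.X i ∪ P.Y i).card

/-- The vector `x`. -/
def x (v : V) : F :=
  (∑ i with v ∈ P.X i, (q * ((P.n i : F) - 1) - 1) / ((q + 1) * P.den q i)) +
  (∑ i with v ∈ P.Y i, (q * ((P.m i : F) - 1) - 1) / ((q + 1) * P.den q i)) -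
  ((P.blockDegree v : F) - 1)

/-- The vector `y`. -/
def y (v : V) : F :=
  (∑ i with v ∈ P.X i, ((P.n i : F) - 1) / P.den q i) +
  (∑ i with v ∈ P.Y i, ((P.m i : F) - 1) / P.den q i) -
  ((P.blockDegree v : F) - 1)

variable [DecidableRel G.Adj]

/-- The weighted adjacency matrix `A` of `G`. Two distinct vertices lie together in at most one
block, so that the sum has at most one term. -/
def A : Matrix V V F :=
  Matrix.of fun u v =>
    if G.Adj u v then
      ∑ i with u ∈ P.X i ∪ P.Y i ∧ v ∈ P.X i ∪ P.Y i, 1 / P.den q i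
    else 0

/-- The weighted adjacency matrix `B` of the complement of `G`. Again at most one term of the
two sums is present. -/
def B : Matrix V V F :=
  Matrix.of fun u v =>
    if u ≠ v ∧ ¬ G.Adj u v then
      (∑ i with u ∈ P.X i ∧ v ∈ P.X i, ((P.n i : F) - 1) / P.den q i) +
      (∑ i with u ∈ P.Y i ∧ v ∈ P.Y i, ((P.m i : F) - 1) / P.den q i)
    else 0

/-- The Laplacian-like matrix `𝓛`. -/
def L : Matrix V V F :=
  (q / (q + 1)) • P.A q - (q ^ 2 / (q + 1)) • P.B q -
    (q ^ 2 / (q + 1)) • Matrix.diagonal (P.y q) + (1 / (q + 1)) • (1 : Matrix V V F)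

end BiBlockLabelling

end SimpleGraph

/-!
# The inverse of the `q`-distance matrix of a bi-block graph

Write `D` for the `q`-distance matrix and `L`, `x`, `λ` for the Laplacian-like matrix, the vector
and the scalar of the statement. Everything follows from the three identities

* `L D + I = x 1ᵀ` (`L_mul_qDistMatrix_apply`),
* `D x = λ 1` (`qDistMatrix_mulVec_x`),
* `1ᵀ x = 1 - (q - 1) λ` (`sum_x`).

If `λ ≠ 0`, then, since `D` is symmetric,
`(-L + λ⁻¹ x xᵀ) D = -L D + λ⁻¹ x (D x)ᵀ = (I - x 1ᵀ) + x 1ᵀ = I`. If `λ = 0`, the last two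
identities say that `x` lies in the kernel of `D` and that its entries have the sum `1`, so `D` is
singular.

The identities are local. Every vertex `v` has a gate `g i v` in the `i`-th block, a vertex that
each walk from `v` to the block visits (`IsBlock.exists_gate`); this rests on the fact that a path with
both ends in a block stays in it (`IsBlock.toSubgraph_le`), by maximality. Hence
`d(w, v) = d(w, g i v) + d(g i v, v)` for `w` in the block, and the `q`-distance `[d(w, v)]` is an
affine function of the `q`-distance from `w` to the gate inside the block
(`IsGate.qDistMatrix_eq`). Both `x` and `L` are sums over the blocks of the corresponding objects of
one complete bipartite graph, up to correction terms in the block degree minus one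
(`x_eq_sum_blockVec`, `L_eq_sum_blockLap`). The contribution of a single block is therefore computed
from the identities `D x = λ 1`, `1ᵀ x = 1 - (q - 1) λ`, `L D + I = x 1ᵀ` and `L 1 = (1 - q) x`
for a complete bipartite graph. The contributions are put together by a count: for `u ≠ v`, exactly one
of the blocks at `u` has its gate of `v` different from `u` (`IsGate.existsUnique_ne`), so the
correction terms cancel.

For transcendental `q`, the scalar `λ` is, up to a nonzero factor, the value at `q` of an integer
polynomial whose constant coefficient is `± ∑ (m i + n i - 1) ≠ 0`
(`lam_ne_zero_of_transcendental`).
-/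

namespace SimpleGraph

variable {V : Type*} {G : SimpleGraph V}

/-! ### Subgraphs without cut-vertices -/

namespace Subgraph

lemma toSubgraph_le_deleteVerts {H : G.Subgraph} {u v x : V} {p : G.Walk u v}
    (hp : p.toSubgraph ≤ H) (hx : x ∉ p.support) : p.toSubgraph ≤ H.deleteVerts {x} := by
  have key : ∀ a, a ∈ p.toSubgraph.verts → a ∈ H.verts ∧ a ∉ ({x} : Set V) := by
    refine fun a ha => ⟨hp.1 ha, ?_⟩
    rintro rfl
    exact hx ((Walk.mem_verts_toSubgraph p).1 ha)
  refine ⟨fun a ha => key a ha, fun a b hab => ?_⟩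
  rw [deleteVerts_adj]
  exact ⟨(key a hab.fst_mem).1, (key a hab.fst_mem).2, (key b hab.snd_mem).1,
    (key b hab.snd_mem).2, hp.2 hab⟩

lemma exists_walk_avoiding {H : G.Subgraph} (hH : H.Connected) (hcut : ∀ v, ¬ H.IsCutVertex v)
    {x u v : V} (hu : u ∈ H.verts) (hv : v ∈ H.verts) (hux : u ≠ x) (hvx : v ≠ x) :
    ∃ p : G.Walk u v, p.toSubgraph ≤ H ∧ x ∉ p.support := by
  by_cases hx : x ∈ H.verts
  · have h : (H.deleteVerts {x}).Preconnected := by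
      by_contra h
      exact hcut x ⟨hx, h⟩
    obtain ⟨p, hp⟩ := (preconnected_iff_forall_exists_walk_subgraph _).1 h
      (u := u) (v := v) ⟨hu, hux⟩ ⟨hv, hvx⟩
    refine ⟨p, hp.trans deleteVerts_le, fun hxp => ?_⟩
    exact (hp.1 ((Walk.mem_verts_toSubgraph p).2 hxp)).2 rfl
  · obtain ⟨p, hp⟩ := ((connected_iff_forall_exists_walk_subgraph _).1 hH).2 hu hv
    exact ⟨p, hp, fun hxp => hx (hp.1 ((Walk.mem_verts_toSubgraph p).2 hxp))⟩

end Subgraph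

/-! ### Blocks and gates -/

namespace IsBlock

variable {B : G.Subgraph}

/-- The form in which the maximality of a block is used: a subgraph `H ⊇ B` is again connected
and without cut-vertex as soon as, whichever vertex `x` is deleted, each other vertex of `H` can
still reach `B` inside `H`. -/
lemma le_of_reachable (hB : G.IsBlock B) {H : G.Subgraph} (hBH : B ≤ H)
    (h : ∀ x, ∀ u ∈ H.verts, u ≠ x →
      ∃ b ∈ B.verts, b ≠ x ∧ ∃ p : G.Walk u b, p.toSubgraph ≤ H ∧ x ∉ p.support) : H ≤ B := by
  have hwalk : ∀ x, ∀ u ∈ H.verts, ∀ v ∈ H.verts, u ≠ x → v ≠ x →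
      ∃ p : G.Walk u v, p.toSubgraph ≤ H ∧ x ∉ p.support := by
    intro x u hu v hv hux hvx
    obtain ⟨b, hb, hbx, p, hp, hxp⟩ := h x u hu hux
    obtain ⟨c, hc, hcx, s, hs, hxs⟩ := h x v hv hvx
    obtain ⟨t, ht, hxt⟩ := Subgraph.exists_walk_avoiding hB.1.1 hB.1.2 hb hc hbx hcx
    refine ⟨p.append (t.append s.reverse), ?_, ?_⟩
    · simp only [Walk.toSubgraph_append, Walk.toSubgraph_reverse]
      exact sup_le hp (sup_le (ht.trans hBH) hs)
    · simp [Walk.mem_support_append_iff, hxp, hxt, hxs]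
  refine hB.le_of_ge ⟨?_, fun x hx => hx.2 ?_⟩ hBH
  · rw [Subgraph.connected_iff_forall_exists_walk_subgraph]
    refine ⟨hB.1.1.nonempty.mono hBH.1, fun {u v} hu hv => ?_⟩
    rcases eq_or_ne u v with rfl | huv
    · exact ⟨Walk.nil, by simpa using hu⟩
    · obtain ⟨b, hb, -, p, hp, -⟩ := h v u hu huv
      obtain ⟨c, hc, -, s, hs, -⟩ := h u v hv huv.symm
      obtain ⟨t, ht⟩ := ((Subgraph.connected_iff_forall_exists_walk_subgraph _).1 hB.1.1).2 hb hc
      refine ⟨p.append (t.append s.reverse), ?_⟩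
      simp only [Walk.toSubgraph_append, Walk.toSubgraph_reverse]
      exact sup_le hp (sup_le (ht.trans hBH) hs)
  · rw [Subgraph.preconnected_iff_forall_exists_walk_subgraph]
    intro u v hu hv
    obtain ⟨p, hp, hxp⟩ := hwalk x u hu.1 v hv.1 hu.2 hv.2
    exact ⟨p, Subgraph.toSubgraph_le_deleteVerts hp hxp⟩

/-- A path with both ends in a block stays in the block. -/
lemma toSubgraph_le (hB : G.IsBlock B) {a b : V} (ha : a ∈ B.verts) (hb : b ∈ B.verts)
    {p : G.Walk a b} (hp : p.IsPath) : p.toSubgraph ≤ B := by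
  classical
  refine le_sup_right.trans (hB.le_of_reachable (H := B ⊔ p.toSubgraph) le_sup_left ?_)
  rintro x u (hu | hu) hux
  · exact ⟨u, hu, hux, Walk.nil, by simpa using Or.inl hu, by simpa using hux.symm⟩
  · have hup := (Walk.mem_verts_toSubgraph p).1 hu
    -- The two pieces into which `u` cuts the path share only `u`, so one of them avoids `x`.
    have hspec := p.take_spec hup
    by_cases hx : x ∈ (p.takeUntil u hup).support
    · have hx' : x ∉ (p.dropUntil u hup).support := by
        intro hx'
        rw [← hspec] at hp
        exact hp.ne_of_mem_support_of_append hux.symm hx hx' rfl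
      refine ⟨b, hb, fun h => hx' (h ▸ Walk.end_mem_support _), p.dropUntil u hup, ?_, hx'⟩
      refine le_sup_of_le_right ?_
      conv_rhs => rw [← hspec, Walk.toSubgraph_append]
      exact le_sup_right
    · refine ⟨a, ha, fun h => hx (h ▸ Walk.start_mem_support _), (p.takeUntil u hup).reverse,
        ?_, by simpa using hx⟩
      refine le_sup_of_le_right ?_
      rw [Walk.toSubgraph_reverse]
      conv_rhs => rw [← hspec, Walk.toSubgraph_append]
      exact le_sup_left

/-- A block is an induced subgraph. -/
lemma adj_of_adj (hB : G.IsBlock B) {a b : V} (ha : a ∈ B.verts) (hb : b ∈ B.verts)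
    (hab : G.Adj a b) : B.Adj a b := by
  have hp : (Walk.cons hab Walk.nil).IsPath := by simp [hab.ne]
  exact (hB.toSubgraph_le ha hb hp).2 (by simp)

lemma eq_of_two_mem {B' : G.Subgraph} (hB : G.IsBlock B) (hB' : G.IsBlock B') {a b : V}
    (hab : a ≠ b) (ha : a ∈ B.verts) (hb : b ∈ B.verts) (ha' : a ∈ B'.verts)
    (hb' : b ∈ B'.verts) : B = B' := by
  have hle : B ⊔ B' ≤ B := by
    -- Deleting a vertex leaves one of the two common vertices.
    refine hB.le_of_reachable le_sup_left ?_
    rintro x u (hu | hu) hux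
    · exact ⟨u, hu, hux, Walk.nil, by simpa using Or.inl hu, by simpa using hux.symm⟩
    · obtain ⟨c, hc, hc', hcx⟩ : ∃ c ∈ B.verts, c ∈ B'.verts ∧ c ≠ x := by
        by_cases hax : a = x
        · exact ⟨b, hb, hb', fun h => hab (hax.trans h.symm)⟩
        · exact ⟨a, ha, ha', hax⟩
      obtain ⟨p, hp, hxp⟩ := Subgraph.exists_walk_avoiding hB'.1.1 hB'.1.2 hu hc' hux hcx
      exact ⟨c, hc, hcx, p, hp.trans le_sup_right, hxp⟩
  have hle' : B' ≤ B := le_sup_right.trans hle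
  exact le_antisymm (hB'.le_of_ge hB.1 hle') hle'

/-- Every vertex `v` has a gate in a block `B`: a vertex of `B` which every walk from `v` to `B`
visits. -/
lemma exists_gate (hG : G.Connected) (hB : G.IsBlock B) (v : V) :
    ∃ g ∈ B.verts, ∀ w ∈ B.verts, ∀ p : G.Walk v w, g ∈ p.support := by
  classical
  obtain ⟨b, hb⟩ := hB.1.1.nonempty
  obtain ⟨q⟩ := hG v b
  induction q with
  | nil => exact ⟨_, hb, fun w _ p => p.start_mem_support⟩
  | @cons v v' b h q ih =>
    by_cases hv : v ∈ B.verts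
    · exact ⟨v, hv, fun w _ p => p.start_mem_support⟩
    obtain ⟨g, hg, hgate⟩ := ih hb
    refine ⟨g, hg, fun w hw p => ?_⟩
    have hmem := hgate w hw (Walk.cons h.symm p)
    rw [Walk.support_cons, List.mem_cons] at hmem
    rcases hmem with rfl | hmem
    · -- Otherwise the edge from `g` to `v` followed by a path from `v` to `w` leaves the block.
      by_contra hgp
      have hpath : (Walk.cons h.symm p.bypass).IsPath :=
        (Walk.cons_isPath_iff _ _).2
          ⟨p.bypass_isPath, fun h' => hgp (p.support_bypass_subset_support h')⟩
      refine hv ((hB.toSubgraph_le hg hw hpath).1 ?_)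
      simp
    · exact hmem

end IsBlock

/-- Every edge lies in a block, since a single edge is connected without cut-vertex. -/
lemma exists_isBlock_adj [Finite V] {u v : V} (h : G.Adj u v) :
    ∃ B : G.Subgraph, G.IsBlock B ∧ B.Adj u v := by
  have hconn := Subgraph.subgraphOfAdj_connected h
  obtain ⟨B, hle, hB⟩ := Finite.exists_le_maximal
    (p := fun H : G.Subgraph => H.Connected ∧ ∀ v, ¬ H.IsCutVertex v)
    (a := G.subgraphOfAdj h) ⟨hconn, by
      rintro x ⟨-, hx⟩
      apply hx
      rw [Subgraph.preconnected_iff_forall_exists_walk_subgraph]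
      intro a b ha hb
      by_cases hab : a = b
      · subst hab
        exact ⟨Walk.nil, by simpa using ha⟩
      · have hax : a ≠ x := ha.2
        have hbx : b ≠ x := hb.2
        obtain ⟨p, hp⟩ :=
          ((Subgraph.connected_iff_forall_exists_walk_subgraph _).1 hconn).2 ha.1 hb.1
        refine ⟨p, Subgraph.toSubgraph_le_deleteVerts hp fun hxp => ?_⟩
        have h1 := hp.1 ((Walk.mem_verts_toSubgraph p).2 hxp)
        have h2 := ha.1
        have h3 := hb.1
        simp only [subgraphOfAdj_verts, Set.mem_insert_iff, Set.mem_singleton_iff] at h1 h2 h3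
        grind⟩
  exact ⟨B, hB, hle.2 (by simp)⟩

/-! ### Distances in a bi-block graph -/

namespace BiBlockLabelling

variable {r : ℕ} (P : G.BiBlockLabelling r)

lemma isBlock (i : Fin r) : G.IsBlock (P.block i).1 := (P.block i).2

variable [DecidableEq V]

lemma mem_verts {i : Fin r} {v : V} : v ∈ (P.block i).1.verts ↔ v ∈ P.X i ∪ P.Y i := by
  rw [(P.isCompleteBipartiteWith i).verts_eq]
  simp

lemma adj_iff {i : Fin r} {u v : V} (hu : u ∈ P.X i ∪ P.Y i) (hv : v ∈ P.X i ∪ P.Y i) :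
    G.Adj u v ↔ (u ∈ P.X i ∧ v ∈ P.Y i) ∨ (u ∈ P.Y i ∧ v ∈ P.X i) := by
  rw [← (P.isCompleteBipartiteWith i).adj_iff]
  exact ⟨(P.isBlock i).adj_of_adj (P.mem_verts.2 hu) (P.mem_verts.2 hv), fun h => h.adj_sub⟩

/-- The distance between two vertices of the `i`-th block. -/
lemma dist_eq (hG : G.Connected) {i : Fin r} {u v : V} (hu : u ∈ P.X i ∪ P.Y i)
    (hv : v ∈ P.X i ∪ P.Y i) :
    G.dist u v = if u = v then 0
      else if (u ∈ P.X i ∧ v ∈ P.Y i) ∨ (u ∈ P.Y i ∧ v ∈ P.X i) then 1 else 2 := by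
  split_ifs with h1 h2
  · simp [h1]
  · exact dist_eq_one_iff_adj.2 ((P.adj_iff hu hv).2 h2)
  · have hne0 : G.dist u v ≠ 0 := fun h => h1 ((hG u v).dist_eq_zero_iff.1 h)
    have hne1 : G.dist u v ≠ 1 := fun h => h2 ((P.adj_iff hu hv).1 (dist_eq_one_iff_adj.1 h))
    -- Both vertices lie in the same part; any vertex of the other part is a common neighbour.
    obtain ⟨c, hc, huc, hcv⟩ : ∃ c ∈ P.X i ∪ P.Y i, G.Adj u c ∧ G.Adj c v := by
      obtain ⟨a, ha⟩ := (P.isCompleteBipartiteWith i).nonempty_left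
      obtain ⟨b, hb⟩ := (P.isCompleteBipartiteWith i).nonempty_right
      have ha' : a ∈ P.X i ∪ P.Y i := Finset.mem_union_left _ ha
      have hb' : b ∈ P.X i ∪ P.Y i := Finset.mem_union_right _ hb
      rcases Finset.mem_union.1 hu with hu' | hu'
      · refine ⟨b, hb', (P.adj_iff hu hb').2 (Or.inl ⟨hu', hb⟩),
          (P.adj_iff hb' hv).2 (Or.inr ⟨hb, ?_⟩)⟩
        rcases Finset.mem_union.1 hv with hv' | hv' <;> tauto
      · refine ⟨a, ha', (P.adj_iff hu ha').2 (Or.inr ⟨hu', ha⟩),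
          (P.adj_iff ha' hv).2 (Or.inl ⟨ha, ?_⟩)⟩
        rcases Finset.mem_union.1 hv with hv' | hv' <;> tauto
    have := hG.dist_triangle (u := u) (v := c) (w := v)
    rw [dist_eq_one_iff_adj.2 huc, dist_eq_one_iff_adj.2 hcv] at this
    omega

/-- `g i v` is a gate of `v` in the `i`-th block, for all `i` and `v`: a vertex of the block that
every walk from `v` to the block visits. -/
def IsGate (g : Fin r → V → V) : Prop :=
  ∀ i v, g i v ∈ P.X i ∪ P.Y i ∧ ∀ w ∈ P.X i ∪ P.Y i, ∀ p : G.Walk v w, g i v ∈ p.support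

lemma exists_isGate (hG : G.Connected) : ∃ g, P.IsGate g := by
  choose g hg hgate using fun i => (P.isBlock i).exists_gate hG
  exact ⟨g, fun i v => ⟨P.mem_verts.1 (hg i v), fun w hw => hgate i v w (P.mem_verts.2 hw)⟩⟩

namespace IsGate

variable {P} {g : Fin r → V → V}

lemma dist_eq_add (hg : P.IsGate g) (hG : G.Connected) {i : Fin r} {w : V}
    (hw : w ∈ P.X i ∪ P.Y i) (v : V) :
    G.dist w v = G.dist w (g i v) + G.dist (g i v) v := by
  refine le_antisymm hG.dist_triangle ?_
  obtain ⟨p, hp⟩ := hG.exists_walk_length_eq_dist v w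
  have hmem := (hg i v).2 w hw p
  have h1 := dist_le (p.takeUntil _ hmem)
  have h2 := dist_le (p.dropUntil _ hmem)
  have h3 := congrArg Walk.length (p.take_spec hmem)
  rw [Walk.length_append] at h3
  rw [dist_comm (u := w) (v := v), dist_comm (u := w), dist_comm (v := v)]
  omega

lemma self_eq (hg : P.IsGate g) (hG : G.Connected) {i : Fin r} {v : V}
    (hv : v ∈ P.X i ∪ P.Y i) : g i v = v := by
  have h := hg.dist_eq_add hG hv v
  rw [dist_self] at h
  exact (hG _ _).dist_eq_zero_iff.1 (by omega)

/-- For `u ≠ v`, exactly one of the blocks at `u` leads towards `v`: in all the others, the gate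
of `v` is `u`. -/
lemma existsUnique_ne [Finite V] (hg : P.IsGate g) (hG : G.Connected)
    {u v : V} (huv : u ≠ v) : ∃! i, u ∈ P.X i ∪ P.Y i ∧ g i v ≠ u := by
  obtain ⟨p, hp, hlen⟩ := hG.exists_path_of_dist u v
  have hnil : ¬ p.Nil := fun h => huv h.eq
  have hadj := p.adj_snd hnil
  -- The block of the first edge of a geodesic from `u` to `v` is the one sought.
  obtain ⟨B, hB, hBadj⟩ := exists_isBlock_adj hadj
  obtain ⟨i, hi⟩ : ∃ i, (P.block i).1 = B :=
    ⟨P.block.symm ⟨B, hB⟩, by rw [Equiv.apply_symm_apply]⟩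
  have hu : u ∈ P.X i ∪ P.Y i := P.mem_verts.1 (hi ▸ hBadj.fst_mem)
  have hs : p.snd ∈ P.X i ∪ P.Y i := P.mem_verts.1 (hi ▸ hBadj.snd_mem)
  have huniq : ∀ j, u ∈ P.X j ∪ P.Y j → g j v ≠ u → p.snd ∈ (P.block j).1.verts := by
    intro j hj hne
    have hmem : g j v ∈ p.support := by simpa using (hg j v).2 u hj p.reverse
    have hle := (P.isBlock j).toSubgraph_le (P.mem_verts.2 hj) (P.mem_verts.2 (hg j v).1)
      (hp.takeUntil hmem)
    refine hle.1 ((Walk.mem_verts_toSubgraph _).2 ?_)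
    rw [← Walk.snd_takeUntil hne p hmem]
    exact Walk.getVert_mem_support _ _
  refine ⟨i, ⟨hu, fun h => ?_⟩, fun j hj => ?_⟩
  · have h1 := hg.dist_eq_add hG hs v
    rw [h, dist_eq_one_iff_adj.2 hadj.symm] at h1
    have h2 := dist_le p.tail
    have h3 := Walk.length_tail_add_one hnil
    omega
  · have h := (P.isBlock j).eq_of_two_mem (P.isBlock i) hadj.ne (P.mem_verts.2 hj.1)
      (huniq j hj.1 hj.2) (P.mem_verts.2 hu) (P.mem_verts.2 hs)
    exact P.block.injective (Subtype.ext h)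

end IsGate

end BiBlockLabelling

/-! ### A single complete bipartite graph -/

namespace BiBlockLabelling

variable {F : Type*} [Field F]

/-- The denominator `q² (m - 1) (n - 1) - 1` of the complete bipartite graph with parts `X`, `Y`. -/
def blockDen (X Y : Finset V) (q : F) : F :=
  q ^ 2 * ((X.card : F) - 1) * ((Y.card : F) - 1) - 1

/-- The contribution of one block to `lam`. -/
def blockLam (X Y : Finset V) (q : F) : F :=
  ((q + 1) ^ 2 * ((X.card : F) - 1) * ((Y.card : F) - 1) - (X.card : F) * (Y.card : F)) /
    ((q + 1) * blockDen X Y q)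

lemma blockDen_comm (X Y : Finset V) (q : F) : blockDen Y X q = blockDen X Y q := by
  unfold blockDen; ring

lemma blockLam_comm (X Y : Finset V) (q : F) : blockLam Y X q = blockLam X Y q := by
  unfold blockLam; rw [blockDen_comm]; ring

variable [DecidableEq V]

/-- The vector `x` of a single block, extended by zero. -/
def blockVec (X Y : Finset V) (q : F) (v : V) : F :=
  (if v ∈ X then (q * ((Y.card : F) - 1) - 1) / ((q + 1) * blockDen X Y q) else 0) +
    (if v ∈ Y then (q * ((X.card : F) - 1) - 1) / ((q + 1) * blockDen X Y q) else 0)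

/-- The off-diagonal weights of the Laplacian of a single block, continued to the diagonal by the
value that belongs to two vertices in the same part. -/
def blockWeight (X Y : Finset V) (q : F) (u v : V) : F :=
  q / (q + 1) * (if (u ∈ X ∧ v ∈ Y) ∨ (u ∈ Y ∧ v ∈ X) then 1 / blockDen X Y q else 0) -
    q ^ 2 / (q + 1) * ((if u ∈ X ∧ v ∈ X then ((Y.card : F) - 1) / blockDen X Y q else 0) +
      (if u ∈ Y ∧ v ∈ Y then ((X.card : F) - 1) / blockDen X Y q else 0))

/-- The matrix `L` of a single block, extended by zero. -/
def blockLap (X Y : Finset V) (q : F) (u v : V) : F :=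
  blockWeight X Y q u v + if u = v ∧ u ∈ X ∪ Y then 1 / (q + 1) else 0

/-- The `q`-distance matrix of a single block. -/
def blockDist (X Y : Finset V) (q : F) (u v : V) : F :=
  if u = v then 0 else if (u ∈ X ∧ v ∈ Y) ∨ (u ∈ Y ∧ v ∈ X) then 1 else 1 + q

variable (X Y : Finset V) (q : F)

lemma blockVec_comm (v : V) : blockVec Y X q v = blockVec X Y q v := by
  unfold blockVec; rw [blockDen_comm, add_comm]

lemma blockWeight_comm (u v : V) : blockWeight Y X q u v = blockWeight X Y q u v := by
  unfold blockWeight; rw [blockDen_comm]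
  simp only [or_comm (a := u ∈ Y ∧ v ∈ X)]
  ring

lemma blockDist_comm (u v : V) : blockDist Y X q u v = blockDist X Y q u v := by
  unfold blockDist; simp only [or_comm (a := u ∈ Y ∧ v ∈ X)]

variable {X Y q}

/-- Sums over a complete bipartite graph of a function constant on either part, weighted by the
`q`-distance to a vertex `g` of the first part. -/
lemma sum_mul_blockDist (hXY : Disjoint X Y) {g : V} (hg : g ∈ X) {f : V → F} {a b : F}
    (hX : ∀ w ∈ X, f w = a) (hY : ∀ w ∈ Y, f w = b) :
    ∑ w ∈ X ∪ Y, f w * blockDist X Y q w g = a * ((1 + q) * ((X.card : F) - 1)) + b * Y.card := by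
  have hgY : g ∉ Y := Finset.disjoint_left.1 hXY hg
  rw [Finset.sum_union hXY]
  have h1 : ∑ w ∈ X, f w * blockDist X Y q w g =
      ∑ w ∈ X, (a * (1 + q) - if w = g then a * (1 + q) else 0) := by
    refine Finset.sum_congr rfl fun w hw => ?_
    have hwY : w ∉ Y := Finset.disjoint_left.1 hXY hw
    rw [hX w hw]
    by_cases h : w = g <;> simp [blockDist, h, hw, hwY, hg, hgY]
  have h2 : ∑ w ∈ Y, f w * blockDist X Y q w g = ∑ w ∈ Y, b := by
    refine Finset.sum_congr rfl fun w hw => ?_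
    have hne : w ≠ g := fun h => hgY (h ▸ hw)
    simp [hY w hw, blockDist, hne, hw, hg]
  rw [h1, h2, Finset.sum_sub_distrib, Finset.sum_ite_eq' X g]
  simp [hg]
  ring

lemma sum_of_const (hXY : Disjoint X Y) {f : V → F} {a b : F}
    (hX : ∀ w ∈ X, f w = a) (hY : ∀ w ∈ Y, f w = b) :
    ∑ w ∈ X ∪ Y, f w = a * X.card + b * Y.card := by
  rw [Finset.sum_union hXY, Finset.sum_congr rfl hX, Finset.sum_congr rfl hY]
  simp [mul_comm]

lemma blockVec_left (hXY : Disjoint X Y) {v : V} (hv : v ∈ X) :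
    blockVec X Y q v = (q * ((Y.card : F) - 1) - 1) / ((q + 1) * blockDen X Y q) := by
  simp [blockVec, hv, Finset.disjoint_left.1 hXY hv]

lemma blockVec_right (hXY : Disjoint X Y) {v : V} (hv : v ∈ Y) :
    blockVec X Y q v = (q * ((X.card : F) - 1) - 1) / ((q + 1) * blockDen X Y q) := by
  simp [blockVec, hv, Finset.disjoint_right.1 hXY hv]

lemma blockWeight_left_left (hXY : Disjoint X Y) {u v : V} (hu : u ∈ X) (hv : v ∈ X) :
    blockWeight X Y q u v = -(q ^ 2 / (q + 1) * (((Y.card : F) - 1) / blockDen X Y q)) := by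
  simp [blockWeight, hu, hv, Finset.disjoint_left.1 hXY hu, Finset.disjoint_left.1 hXY hv]

lemma blockWeight_left_right (hXY : Disjoint X Y) {u v : V} (hu : u ∈ X) (hv : v ∈ Y) :
    blockWeight X Y q u v = q / (q + 1) * (1 / blockDen X Y q) := by
  simp [blockWeight, hu, hv, Finset.disjoint_left.1 hXY hu, Finset.disjoint_right.1 hXY hv]

/-- `D x = λ 1` on a single block. -/
lemma sum_blockVec_mul_blockDist (hXY : Disjoint X Y) (hq : q + 1 ≠ 0) (hw : blockDen X Y q ≠ 0)
    {g : V} (hg : g ∈ X ∪ Y) :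
    ∑ w ∈ X ∪ Y, blockVec X Y q w * blockDist X Y q w g = blockLam X Y q := by
  -- By symmetry, it suffices to treat a distinguished vertex in the first part.
  have key : ∀ {X Y : Finset V}, Disjoint X Y → blockDen X Y q ≠ 0 → ∀ {g : V}, g ∈ X →
      ∑ w ∈ X ∪ Y, blockVec X Y q w * blockDist X Y q w g = blockLam X Y q := by
    intro X Y hXY hw g hg
    rw [sum_mul_blockDist hXY hg (fun w hw => blockVec_left hXY hw)
      (fun w hw => blockVec_right hXY hw), blockLam]
    field_simp
    ring
  rcases Finset.mem_union.1 hg with hg | hg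
  · exact key hXY hw hg
  · have := key hXY.symm (by rwa [blockDen_comm]) hg
    simpa only [blockVec_comm X Y, blockDist_comm X Y, blockLam_comm X Y, Finset.union_comm Y X]
      using this

lemma sum_blockVec (hXY : Disjoint X Y) (hq : q + 1 ≠ 0) (hw : blockDen X Y q ≠ 0) :
    ∑ w ∈ X ∪ Y, blockVec X Y q w = 1 - (q - 1) * blockLam X Y q := by
  rw [sum_of_const hXY (fun w hw => blockVec_left hXY hw)
      (fun w hw => blockVec_right hXY hw), blockLam]
  field_simp
  rw [blockDen]
  ring

lemma sum_blockLap_mul {u : V} (hu : u ∈ X ∪ Y) (f : V → F) :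
    ∑ w ∈ X ∪ Y, blockLap X Y q u w * f w =
      ∑ w ∈ X ∪ Y, blockWeight X Y q u w * f w + 1 / (q + 1) * f u := by
  have h : ∀ w, blockLap X Y q u w * f w =
      blockWeight X Y q u w * f w + if u = w then 1 / (q + 1) * f w else 0 := by
    intro w
    by_cases h : u = w <;> simp [blockLap, h, add_mul]
    intro h1 h2
    subst h
    simp [h1, h2] at hu
  simp only [h, Finset.sum_add_distrib, Finset.sum_ite_eq, hu, if_true]

/-- `L 1 = (1 - q) x` on a single block. -/
lemma sum_blockLap (hXY : Disjoint X Y) (hq : q + 1 ≠ 0) (hw : blockDen X Y q ≠ 0)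
    {u : V} (hu : u ∈ X ∪ Y) :
    ∑ w ∈ X ∪ Y, blockLap X Y q u w = (1 - q) * blockVec X Y q u := by
  -- By symmetry, it suffices to treat a distinguished vertex in the first part.
  have key : ∀ {X Y : Finset V}, Disjoint X Y → blockDen X Y q ≠ 0 → ∀ {u : V}, u ∈ X →
      ∑ w ∈ X ∪ Y, blockWeight X Y q u w + 1 / (q + 1) = (1 - q) * blockVec X Y q u := by
    intro X Y hXY hw u hu
    rw [sum_of_const hXY (fun w hw => blockWeight_left_left hXY hu hw)
      (fun w hw => blockWeight_left_right hXY hu hw), blockVec_left hXY hu]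
    field_simp
    rw [blockDen]
    ring
  have h := sum_blockLap_mul (q := q) hu (fun _ => 1)
  simp only [mul_one] at h
  rw [h]
  rcases Finset.mem_union.1 hu with hu | hu
  · exact key hXY hw hu
  · have := key hXY.symm (by rwa [blockDen_comm]) hu
    simpa only [blockVec_comm X Y, blockWeight_comm X Y, Finset.union_comm Y X] using this

/-- `L D + I = x 1ᵀ` on a single block. -/
lemma sum_blockLap_mul_blockDist (hXY : Disjoint X Y) (hq : q + 1 ≠ 0) (hw : blockDen X Y q ≠ 0)
    {u g : V} (hu : u ∈ X ∪ Y) (hg : g ∈ X ∪ Y) :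
    ∑ w ∈ X ∪ Y, blockLap X Y q u w * blockDist X Y q w g =
      blockVec X Y q u - if u = g then 1 else 0 := by
  -- By symmetry, it suffices to treat a distinguished vertex in the first part.
  have key : ∀ {X Y : Finset V}, Disjoint X Y → blockDen X Y q ≠ 0 → ∀ {u g : V}, u ∈ X ∪ Y →
      g ∈ X → ∑ w ∈ X ∪ Y, blockWeight X Y q u w * blockDist X Y q w g +
        1 / (q + 1) * blockDist X Y q u g = blockVec X Y q u - if u = g then 1 else 0 := by
    intro X Y hXY hw u g hu hg
    have hgY : g ∉ Y := Finset.disjoint_left.1 hXY hg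
    rcases Finset.mem_union.1 hu with hu | hu
    · have huY : u ∉ Y := Finset.disjoint_left.1 hXY hu
      rw [sum_mul_blockDist hXY hg (fun w hw => blockWeight_left_left hXY hu hw)
        (fun w hw => blockWeight_left_right hXY hu hw), blockVec_left hXY hu]
      by_cases hug : u = g
      · simp only [blockDist, hug, if_true]
        field_simp
        rw [blockDen]
        ring
      · simp only [blockDist, hug, hu, hg, hgY, huY, if_false, false_and, and_false, or_self]
        field_simp
        rw [blockDen]
        ring
    · have hug : u ≠ g := fun h => hgY (h ▸ hu)
      rw [sum_mul_blockDist hXY hg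
        (fun w hw => by rw [← blockWeight_comm, blockWeight_left_right hXY.symm hu hw])
        (fun w hw => by rw [← blockWeight_comm, blockWeight_left_left hXY.symm hu hw]),
        blockVec_right hXY hu, blockDen_comm X Y]
      simp only [blockDist, hug, hu, hg, if_false, true_and, or_true, if_true]
      field_simp
      rw [blockDen]
      ring
  rw [sum_blockLap_mul hu]
  rcases Finset.mem_union.1 hg with hg | hg
  · exact key hXY hw hu hg
  · have := key hXY.symm (by rwa [blockDen_comm]) (u := u) (by rwa [Finset.union_comm]) hg
    simpa only [blockVec_comm X Y, blockWeight_comm X Y, blockDist_comm X Y,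
      Finset.union_comm Y X] using this

end BiBlockLabelling

/-! ### `q`-numbers and the constant `λ` -/

section QNumber

variable {F : Type*} [Field F] (q : F)

lemma one_add_mul_geom_sum (a : ℕ) :
    1 + (q - 1) * ∑ k ∈ Finset.range a, q ^ k = q ^ a := by
  rw [mul_geom_sum]; ring

lemma geom_sum_add (a b : ℕ) : ∑ k ∈ Finset.range (a + b), q ^ k =
    ∑ k ∈ Finset.range a, q ^ k + ∑ k ∈ Finset.range b, q ^ k +
      (q - 1) * (∑ k ∈ Finset.range a, q ^ k) * ∑ k ∈ Finset.range b, q ^ k := by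
  simp only [Finset.sum_range_add, pow_add, ← Finset.mul_sum]
  rw [← one_add_mul_geom_sum q a]
  ring

end QNumber

variable {F : Type*} [Field F] {q : F}

lemma qDistMatrix_comm (u v : V) : G.qDistMatrix q u v = G.qDistMatrix q v u := by
  simp only [qDistMatrix, Matrix.of_apply, dist_comm]

lemma qDistMatrix_self (v : V) : G.qDistMatrix q v v = 0 := by
  simp [qDistMatrix]

namespace BiBlockLabelling

variable {r : ℕ} {P : G.BiBlockLabelling r}

lemma disjoint (P : G.BiBlockLabelling r) (i : Fin r) : Disjoint (P.X i) (P.Y i) :=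
  (P.isCompleteBipartiteWith i).disjoint

/-- Clearing denominators makes `λ_G` the value at `q` of an integer polynomial, and its constant
coefficient is `± ∑ (m i + n i - 1) ≠ 0`. -/
theorem lam_ne_zero_of_transcendental (hr : 0 < r) (hq : q + 1 ≠ 0) (hden : ∀ i, P.den q i ≠ 0)
    (htr : Transcendental ℤ q) : P.lam q ≠ 0 := by
  intro hlam
  let num : Fin r → Polynomial ℤ := fun i =>
    (Polynomial.X + 1) ^ 2 * ((P.m i : Polynomial ℤ) - 1) * ((P.n i : Polynomial ℤ) - 1) -
      (P.m i : Polynomial ℤ) * (P.n i : Polynomial ℤ)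
  let den : Fin r → Polynomial ℤ := fun i =>
    Polynomial.X ^ 2 * ((P.m i : Polynomial ℤ) - 1) * ((P.n i : Polynomial ℤ) - 1) - 1
  let N : Polynomial ℤ := ∑ i, num i * ∏ j ∈ Finset.univ.erase i, den j
  have hdenq : ∀ i, Polynomial.aeval q (den i) = P.den q i := by
    intro i
    simp [den, BiBlockLabelling.den]
  have hNq : Polynomial.aeval q N = 0 := by
    have h : Polynomial.aeval q N = (q + 1) * (∏ j, P.den q j) * P.lam q := by
      simp only [N, map_sum, map_mul, map_prod, hdenq, lam, Finset.mul_sum]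
      refine Finset.sum_congr rfl fun i _ => ?_
      rw [← Finset.mul_prod_erase _ _ (Finset.mem_univ i)]
      have := hden i
      simp [num]
      field_simp
    rw [h, hlam, mul_zero]
  have hN : N = 0 := by
    by_contra hN
    exact htr ⟨N, hN, hNq⟩
  have hN0 : N.eval 0 = (-1) ^ r * ∑ i, ((P.m i : ℤ) + P.n i - 1) := by
    rw [Finset.mul_sum]
    simp only [N, Polynomial.eval_finsetSum, Polynomial.eval_mul, Polynomial.eval_prod]
    refine Finset.sum_congr rfl fun i _ => ?_
    have h1 : ∀ j, (den j).eval 0 = -1 := fun j => by simp [den]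
    obtain ⟨s, rfl⟩ : ∃ s, r = s + 1 := ⟨r - 1, by omega⟩
    simp [h1, num, pow_succ]
    ring
  rw [hN, Polynomial.eval_zero] at hN0
  have hpos : 0 < ∑ i, ((P.m i : ℤ) + P.n i - 1) := by
    refine Finset.sum_pos (fun i _ => ?_) ⟨⟨0, hr⟩, Finset.mem_univ _⟩
    have h1 : 0 < P.m i := (P.isCompleteBipartiteWith i).nonempty_left.card_pos
    have h2 : 0 < P.n i := (P.isCompleteBipartiteWith i).nonempty_right.card_pos
    omega
  exact (mul_ne_zero (pow_ne_zero r (by norm_num)) hpos.ne') hN0.symm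

/-! ### The identities `L D + I = x 1ᵀ`, `D x = λ 1` and `1ᵀ x = 1 - (q - 1) λ` -/

variable [DecidableEq V]

lemma qDistMatrix_eq_blockDist (hG : G.Connected) {i : Fin r} {u v : V}
    (hu : u ∈ P.X i ∪ P.Y i) (hv : v ∈ P.X i ∪ P.Y i) :
    G.qDistMatrix q u v = blockDist (P.X i) (P.Y i) q u v := by
  rw [qDistMatrix, Matrix.of_apply, P.dist_eq hG hu hv, blockDist]
  split_ifs <;> simp [Finset.sum_range_succ]

/-- The `q`-analogue of additivity of distances along the gate `g i v`. -/
lemma IsGate.qDistMatrix_eq {g : Fin r → V → V} (hg : P.IsGate g) (hG : G.Connected)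
    {i : Fin r} {w : V} (hw : w ∈ P.X i ∪ P.Y i) (v : V) :
    G.qDistMatrix q w v = blockDist (P.X i) (P.Y i) q w (g i v) *
      (1 + (q - 1) * G.qDistMatrix q (g i v) v) + G.qDistMatrix q (g i v) v := by
  rw [← qDistMatrix_eq_blockDist hG hw (hg i v).1]
  simp only [qDistMatrix, Matrix.of_apply]
  rw [hg.dist_eq_add hG hw v, geom_sum_add]
  ring

lemma blockDegree_eq_sum (P : G.BiBlockLabelling r) (u : V) :
    (P.blockDegree u : F) = ∑ i, if u ∈ P.X i ∪ P.Y i then 1 else 0 := by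
  simp [blockDegree]

/-- If `u ≠ v`, all blocks at `u` but one have `u` as the gate of `v`; if `u = v`, all of them
do. -/
lemma IsGate.sum_eq [Finite V] {g : Fin r → V → V} (hg : P.IsGate g) (hG : G.Connected)
    (u v : V) : ∑ i, (if u ∈ P.X i ∪ P.Y i ∧ g i v = u then 1 else 0 : F) =
      (P.blockDegree u : F) - if u = v then 0 else 1 := by
  rw [blockDegree_eq_sum]
  by_cases huv : u = v
  · subst huv
    rw [if_pos rfl, sub_zero]
    refine Finset.sum_congr rfl fun i _ => if_congr ⟨And.left, fun h => ⟨h, ?_⟩⟩ rfl rfl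
    exact hg.self_eq hG h
  · obtain ⟨j, hj, hjuniq⟩ := hg.existsUnique_ne hG huv
    have h : ∀ i, (if u ∈ P.X i ∪ P.Y i ∧ g i v = u then 1 else 0 : F) =
        (if u ∈ P.X i ∪ P.Y i then 1 else 0) - if i = j then 1 else 0 := by
      intro i
      by_cases hij : i = j
      · subst hij
        rw [if_neg (fun h => hj.2 h.2), if_pos hj.1, if_pos rfl, sub_self]
      · rw [if_neg hij, sub_zero]
        refine if_congr ⟨And.left, fun h => ⟨h, ?_⟩⟩ rfl rfl
        by_contra hne
        exact hij (hjuniq i ⟨h, hne⟩)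
    simp only [h, Finset.sum_sub_distrib, if_neg huv, Finset.sum_ite_eq', Finset.mem_univ, if_true]

lemma x_eq_sum_blockVec (P : G.BiBlockLabelling r) (q : F) (v : V) :
    P.x q v = ∑ i, blockVec (P.X i) (P.Y i) q v - ((P.blockDegree v : F) - 1) := by
  simp only [x, blockVec, Finset.sum_filter, Finset.sum_add_distrib]
  rfl

lemma L_eq_sum_blockLap [DecidableRel G.Adj] (P : G.BiBlockLabelling r) (hq : q + 1 ≠ 0)
    (u v : V) : P.L q u v = ∑ i, blockLap (P.X i) (P.Y i) q u v +
      if u = v then (q - 1) * ((P.blockDegree u : F) - 1) else 0 := by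
  have hA : P.A q u v = ∑ i, if (u ∈ P.X i ∧ v ∈ P.Y i) ∨ (u ∈ P.Y i ∧ v ∈ P.X i) then
      1 / blockDen (P.X i) (P.Y i) q else 0 := by
    rw [A, Matrix.of_apply, Finset.sum_filter]
    split_ifs with h
    · refine Finset.sum_congr rfl fun i _ => if_congr ⟨fun h' => (P.adj_iff h'.1 h'.2).1 h, ?_⟩
        rfl rfl
      simp only [Finset.mem_union]
      tauto
    · refine (Finset.sum_eq_zero fun i _ => if_neg fun h' => h ?_).symm
      exact (P.adj_iff (by simp only [Finset.mem_union]; tauto)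
        (by simp only [Finset.mem_union]; tauto)).2 h'
  have hw : ∑ i, blockWeight (P.X i) (P.Y i) q u v = q / (q + 1) * P.A q u v -
      q ^ 2 / (q + 1) * ((∑ i with u ∈ P.X i ∧ v ∈ P.X i, ((P.n i : F) - 1) / P.den q i) +
        ∑ i with u ∈ P.Y i ∧ v ∈ P.Y i, ((P.m i : F) - 1) / P.den q i) := by
    rw [hA]
    simp only [blockWeight, Finset.sum_sub_distrib, ← Finset.mul_sum, Finset.sum_add_distrib,
      Finset.sum_filter]
    rfl
  simp only [L, blockLap, Finset.sum_add_distrib, hw, Matrix.add_apply, Matrix.sub_apply,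
    Matrix.smul_apply, smul_eq_mul, Matrix.diagonal_apply, Matrix.one_apply]
  by_cases huv : u = v
  · subst huv
    have hB : P.B q u u = 0 := by simp [B]
    have hk : ∑ i, (if u = u ∧ u ∈ P.X i ∪ P.Y i then 1 / (q + 1) else 0) =
        1 / (q + 1) * (P.blockDegree u : F) := by
      rw [blockDegree_eq_sum, Finset.mul_sum]
      simp
    rw [hB, hk, y]
    simp only [if_true, and_self]
    field_simp
    ring
  · have hB : P.B q u v = (∑ i with u ∈ P.X i ∧ v ∈ P.X i, ((P.n i : F) - 1) / P.den q i) +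
        ∑ i with u ∈ P.Y i ∧ v ∈ P.Y i, ((P.m i : F) - 1) / P.den q i := by
      rw [B, Matrix.of_apply]
      by_cases h : G.Adj u v
      · -- Adjacent vertices are never in the same part of a block.
        rw [if_neg (by simp [h]), Finset.filter_false_of_mem, Finset.filter_false_of_mem]
        · simp
        · rintro i - ⟨hu, hv⟩
          have := (P.adj_iff (Finset.mem_union_right _ hu) (Finset.mem_union_right _ hv)).1 h
          have hd := Finset.disjoint_left.1 (P.disjoint i)
          grind
        · rintro i - ⟨hu, hv⟩
          have := (P.adj_iff (Finset.mem_union_left _ hu) (Finset.mem_union_left _ hv)).1 h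
          have hd := Finset.disjoint_left.1 (P.disjoint i)
          grind
      · rw [if_pos ⟨huv, h⟩]
    rw [hB]
    simp [huv]

variable [Fintype V]

lemma sum_blockVec_mul_eq (i : Fin r) (f : V → F) :
    ∑ w, blockVec (P.X i) (P.Y i) q w * f w =
      ∑ w ∈ P.X i ∪ P.Y i, blockVec (P.X i) (P.Y i) q w * f w := by
  refine (Finset.sum_subset (Finset.subset_univ _) fun w _ hw => ?_).symm
  simp only [Finset.mem_union, not_or] at hw
  simp [blockVec, hw.1, hw.2]

/-- The sum of `f` over the vertices, each counted once less than the number of its blocks, in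
terms of the gates of any vertex `v`. -/
lemma IsGate.sum_blockDegree_mul {g : Fin r → V → V} (hg : P.IsGate g) (hG : G.Connected)
    (v : V) (f : V → F) :
    ∑ w, ((P.blockDegree w : F) - 1) * f w = ∑ i, f (g i v) - f v := by
  have h : ∀ w, ((P.blockDegree w : F) - 1) * f w =
      (∑ i, if g i v = w then f w else 0) - if v = w then f w else 0 := by
    intro w
    have h1 := hg.sum_eq (F := F) hG w v
    have h2 : ∀ i, (if w ∈ P.X i ∪ P.Y i ∧ g i v = w then 1 else 0 : F) =
        if g i v = w then 1 else 0 :=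
      fun i => if_congr ⟨And.right, fun h => ⟨h ▸ (hg i v).1, h⟩⟩ rfl rfl
    have h3 : ∑ i, (if g i v = w then f w else 0) =
        (∑ i, if g i v = w then 1 else 0 : F) * f w := by
      rw [Finset.sum_mul]
      simp only [ite_mul, one_mul, zero_mul]
    rw [h3, ← Finset.sum_congr rfl fun i _ => h2 i, h1]
    by_cases hwv : v = w
    · simp [hwv]; ring
    · simp [hwv, Ne.symm hwv]
  simp only [h, Finset.sum_sub_distrib]
  rw [Finset.sum_comm]
  simp

/-- The entries of `x` have the sum `1 - (q - 1) λ`. -/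
theorem sum_x (hG : G.Connected) (hq : q + 1 ≠ 0) (hden : ∀ i, P.den q i ≠ 0) :
    ∑ v, P.x q v = 1 - (q - 1) * P.lam q := by
  obtain ⟨g, hg⟩ := P.exists_isGate hG
  obtain ⟨v⟩ := hG.nonempty
  have h1 := hg.sum_blockDegree_mul (F := F) hG v (fun _ => 1)
  have h2 : ∀ i, ∑ w, blockVec (P.X i) (P.Y i) q w =
      1 - (q - 1) * blockLam (P.X i) (P.Y i) q := by
    intro i
    rw [← sum_blockVec (P.disjoint i) hq (hden i)]
    simpa using sum_blockVec_mul_eq (P := P) (q := q) i (fun _ => 1)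
  simp only [mul_one] at h1
  simp only [x_eq_sum_blockVec]
  rw [Finset.sum_sub_distrib, Finset.sum_comm, h1, Finset.sum_congr rfl fun i _ => h2 i,
    Finset.sum_sub_distrib, ← Finset.mul_sum]
  change _ - (q - 1) * P.lam q - _ = _
  ring

/-- `D x = λ 1`. -/
theorem qDistMatrix_mulVec_x (hG : G.Connected) (hq : q + 1 ≠ 0) (hden : ∀ i, P.den q i ≠ 0) :
    G.qDistMatrix q *ᵥ P.x q = fun _ => P.lam q := by
  obtain ⟨g, hg⟩ := P.exists_isGate hG
  ext v
  have h2 : ∀ i, ∑ w, blockVec (P.X i) (P.Y i) q w * G.qDistMatrix q w v =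
      blockLam (P.X i) (P.Y i) q + G.qDistMatrix q (g i v) v := by
    intro i
    have h : ∀ w ∈ P.X i ∪ P.Y i, blockVec (P.X i) (P.Y i) q w * G.qDistMatrix q w v =
        blockVec (P.X i) (P.Y i) q w * blockDist (P.X i) (P.Y i) q w (g i v) *
          (1 + (q - 1) * G.qDistMatrix q (g i v) v) +
        blockVec (P.X i) (P.Y i) q w * G.qDistMatrix q (g i v) v := by
      intro w hw
      rw [hg.qDistMatrix_eq hG hw v]
      ring
    rw [sum_blockVec_mul_eq, Finset.sum_congr rfl h, Finset.sum_add_distrib, ← Finset.sum_mul,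
      ← Finset.sum_mul, sum_blockVec_mul_blockDist (P.disjoint i) hq (hden i) (hg i v).1,
      sum_blockVec (P.disjoint i) hq (hden i)]
    ring
  have h3 : ∀ w, G.qDistMatrix q v w * P.x q w =
      ∑ i, blockVec (P.X i) (P.Y i) q w * G.qDistMatrix q w v -
        ((P.blockDegree w : F) - 1) * G.qDistMatrix q w v := by
    intro w
    rw [x_eq_sum_blockVec, qDistMatrix_comm v w, ← Finset.sum_mul]
    ring
  rw [Matrix.mulVec, dotProduct, Finset.sum_congr rfl fun w _ => h3 w, Finset.sum_sub_distrib,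
    Finset.sum_comm, Finset.sum_congr rfl fun i _ => h2 i, hg.sum_blockDegree_mul hG v,
    Finset.sum_add_distrib, qDistMatrix_self]
  change P.lam q + _ - _ = _
  ring

/-- The contribution of a single block to `L D`. -/
lemma IsGate.sum_blockLap_mul_qDistMatrix {g : Fin r → V → V} (hg : P.IsGate g)
    (hG : G.Connected) (hq : q + 1 ≠ 0) (hden : ∀ i, P.den q i ≠ 0) (i : Fin r) (u v : V) :
    ∑ w, blockLap (P.X i) (P.Y i) q u w * G.qDistMatrix q w v = blockVec (P.X i) (P.Y i) q u -
      (if u ∈ P.X i ∪ P.Y i ∧ g i v = u then 1 else 0) *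
        (1 + (q - 1) * G.qDistMatrix q u v) := by
  by_cases hu : u ∈ P.X i ∪ P.Y i
  · have h0 : ∑ w, blockLap (P.X i) (P.Y i) q u w * G.qDistMatrix q w v =
        ∑ w ∈ P.X i ∪ P.Y i, blockLap (P.X i) (P.Y i) q u w * G.qDistMatrix q w v := by
      refine (Finset.sum_subset (Finset.subset_univ _) fun w _ hw => ?_).symm
      have huw : u ≠ w := fun h => hw (h ▸ hu)
      simp only [Finset.mem_union, not_or] at hw
      simp [blockLap, blockWeight, hw.1, hw.2, huw]
    have h : ∀ w ∈ P.X i ∪ P.Y i, blockLap (P.X i) (P.Y i) q u w * G.qDistMatrix q w v =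
        blockLap (P.X i) (P.Y i) q u w * blockDist (P.X i) (P.Y i) q w (g i v) *
          (1 + (q - 1) * G.qDistMatrix q (g i v) v) +
        blockLap (P.X i) (P.Y i) q u w * G.qDistMatrix q (g i v) v := by
      intro w hw
      rw [hg.qDistMatrix_eq hG hw v]
      ring
    rw [h0, Finset.sum_congr rfl h, Finset.sum_add_distrib, ← Finset.sum_mul, ← Finset.sum_mul,
      sum_blockLap_mul_blockDist (P.disjoint i) hq (hden i) hu (hg i v).1,
      sum_blockLap (P.disjoint i) hq (hden i) hu]
    by_cases hgu : g i v = u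
    · rw [hgu, if_pos rfl, if_pos ⟨hu, rfl⟩]
      ring
    · rw [if_neg (Ne.symm hgu), if_neg fun h => hgu h.2]
      ring
  · have huX : u ∉ P.X i := fun h => hu (Finset.mem_union_left _ h)
    have huY : u ∉ P.Y i := fun h => hu (Finset.mem_union_right _ h)
    simp [blockLap, blockWeight, blockVec, huX, huY]

/-- `L D + I = x 1ᵀ`. -/
theorem L_mul_qDistMatrix_apply [DecidableRel G.Adj] (hG : G.Connected) (hq : q + 1 ≠ 0)
    (hden : ∀ i, P.den q i ≠ 0) (u v : V) :
    (P.L q * G.qDistMatrix q) u v = P.x q u - if u = v then 1 else 0 := by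
  obtain ⟨g, hg⟩ := P.exists_isGate hG
  have h : ∀ w, P.L q u w * G.qDistMatrix q w v =
      ∑ i, blockLap (P.X i) (P.Y i) q u w * G.qDistMatrix q w v +
        if u = w then (q - 1) * ((P.blockDegree u : F) - 1) * G.qDistMatrix q w v else 0 := by
    intro w
    rw [L_eq_sum_blockLap P hq, add_mul, Finset.sum_mul, ite_mul, zero_mul]
  rw [Matrix.mul_apply, Finset.sum_congr rfl fun w _ => h w, Finset.sum_add_distrib,
    Finset.sum_comm,
    Finset.sum_congr rfl fun i _ => hg.sum_blockLap_mul_qDistMatrix hG hq hden i u v,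
    Finset.sum_sub_distrib, ← Finset.sum_mul, hg.sum_eq hG, x_eq_sum_blockVec]
  simp only [Finset.sum_ite_eq, Finset.mem_univ, if_true]
  by_cases huv : u = v
  · subst huv
    simp only [if_true, qDistMatrix_self]
    ring
  · simp only [huv, if_false]
    ring

end BiBlockLabelling

end SimpleGraph

theorem mainTheorem2 {V : Type*} [Fintype V] [DecidableEq V] (G : SimpleGraph V)
    [DecidableRel G.Adj] (hG : G.IsBiBlock) {r : ℕ} (hr : 1 < r) (P : G.BiBlockLabelling r)
    {F : Type*} [Field F] (q : F) (hq : q ≠ -1)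
    (hcon : ∀ i, q ^ 2 * ((P.m i : F) - 1) * ((P.n i : F) - 1) ≠ 1)
    (hcon1 : ∀ i, (q + 1) ^ 2 * ((P.m i : F) - 1) * ((P.n i : F) - 1) ≠ (P.m i : F) * (P.n i : F)) :
    (Transcendental ℤ q → P.lam q ≠ 0) ∧
    (IsUnit (G.qDistMatrix q) ↔ P.lam q ≠ 0) ∧
    (P.lam q ≠ 0 →
      (G.qDistMatrix q)⁻¹ = -P.L q + (1 / P.lam q) • Matrix.vecMulVec (P.x q) (P.x q)) := by
  have hq1 : q + 1 ≠ 0 := fun h => hq (eq_neg_of_add_eq_zero_left h)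
  have hden : ∀ i, P.den q i ≠ 0 := fun i h => hcon i (sub_eq_zero.1 h)
  have hx := SimpleGraph.BiBlockLabelling.qDistMatrix_mulVec_x (P := P) hG.connected hq1 hden
  have hinv : P.lam q ≠ 0 →
      (-P.L q + (1 / P.lam q) • Matrix.vecMulVec (P.x q) (P.x q)) * G.qDistMatrix q = 1 := by
    intro hlam
    ext u v
    -- As `D` is symmetric, `x xᵀ D = x (D x)ᵀ = λ x 1ᵀ`.
    have hv : (Matrix.vecMulVec (P.x q) (P.x q) * G.qDistMatrix q) u v = P.x q u * P.lam q := by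
      rw [Matrix.mul_apply, ← congrFun hx v, Matrix.mulVec, dotProduct, Finset.mul_sum]
      refine Finset.sum_congr rfl fun w _ => ?_
      rw [Matrix.vecMulVec_apply, SimpleGraph.qDistMatrix_comm w v]
      ring
    rw [add_mul, Matrix.neg_mul, Matrix.smul_mul, Matrix.add_apply, Matrix.neg_apply,
      Matrix.smul_apply,
      SimpleGraph.BiBlockLabelling.L_mul_qDistMatrix_apply hG.connected hq1 hden, hv,
      Matrix.one_apply, smul_eq_mul]
    field_simp
    ring
  refine ⟨SimpleGraph.BiBlockLabelling.lam_ne_zero_of_transcendental (by omega) hq1 hden,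
    ⟨fun hD hlam => ?_, fun hlam => ?_⟩,
    fun hlam => Matrix.inv_eq_left_inv (hinv hlam)⟩
  · -- If `λ = 0`, then `x` is in the kernel of `D`, although its entries have sum `1`.
    have hx0 : P.x q = 0 := by
      refine Matrix.mulVec_injective_of_isUnit hD ?_
      rw [hx, Matrix.mulVec_zero, hlam]
      rfl
    have hsum := SimpleGraph.BiBlockLabelling.sum_x (P := P) hG.connected hq1 hden
    simp [hx0, hlam] at hsum
  · exact IsUnit.of_mul_eq_one_right _ (hinv hlam)
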